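/- Let $k$ be an algebraically closed field of arbitrary characteristic. Let $\mathcal{C}$ be a finite EI category, i.e. a category with only finitely many morphisms in which every endomorphism is an isomorphism, and suppose that $\mathcal{C}$ has exactly two objects, $x \neq y$. Put $G = \mathcal{C}(x,x)$ and $H = \mathcal{C}(y,y)$, so that $G$ acts on $\mathcal{C}(x,y)$ from the right and $H$ acts on it from the left, by composition. Suppose that $\mathcal{C}(x,y)$ is a single $(H,G)$-biset orbit, i.e. there is $\alpha \in \mathcal{C}(x,y)$ with $\mathcal{C}(x,y) = H\alpha G$. If neither $G$ nor $H$ acts transitively on $\mathcal{C}(x,y)$, then $\mathcal{C}$ is of infinite representation type over $k$: there are infinitely many isomorphism classes of indecomposable representations of $\mathcal{C}$, a representation being a functor from $\mathcal{C}$ to the category of finite-dimensional $k$-vector spaces. -/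

import Mathlib

open CategoryTheory CategoryTheory.Limits

/-- A finite EI category: it has only finitely many morphisms (hence, through the identities, only
finitely many objects), and every endomorphism is an isomorphism. -/
structure IsFiniteEI (C : Type*) [Category C] : Prop where
  finite_mor : Finite (Σ (x : C) (y : C), x ⟶ y)
  isIso_of_end : ∀ (x : C) (f : x ⟶ x), IsIso f

/-- A representation of `C` over the field `k`: a functor from `C` to the category of
finite-dimensional `k`-vector spaces; homomorphisms are the natural transformations. The vector
spaces live in the universe of `k`, so that every finite-dimensional space occurs up to
isomorphism. -/
abbrev CatRep.{u, v, w} (k : Type u) [Field k] (C : Type v) [Category.{w} C] :=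
  C ⥤ FGModuleCat.{u} k

/-- `C` is of finite representation type over `k` if there are only finitely many isomorphism
classes of indecomposable representations. Here `Indecomposable R` says that `R` is nonzero and
that in every decomposition `R ≅ Y ⊞ Z` one of the summands is zero. -/
def IsFiniteRepType.{u, v, w} (k : Type u) [Field k] (C : Type v) [Category.{w} C] : Prop :=
  {c : Quotient (isIsomorphicSetoid (CatRep k C)) |
    ∃ R : CatRep k C, Indecomposable R ∧ Quotient.mk (isIsomorphicSetoid (CatRep k C)) R = c}.Finite

/-- `C` is of infinite representation type over `k` if it is not of finite representation type. -/
def IsInfiniteRepType.{u, v, w} (k : Type u) [Field k] (C : Type v) [Category.{w} C] : Prop :=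
  ¬ IsFiniteRepType k C

/-- The set `C(x, y)` is a single orbit under the left action of `H = C(y, y)` and the right action
of `G = C(x, x)`: it is nonempty, and `C(x, y) = H α G` for some `α`. (Mathlib writes the composite
`h α g` as `g ≫ α ≫ h`.) -/
def IsSingleBisetOrbit {C : Type*} [Category C] (x y : C) : Prop :=
  ∃ α : x ⟶ y, ∀ β : x ⟶ y, ∃ (g : x ⟶ x) (h : y ⟶ y), β = g ≫ α ≫ h

/-- `G = C(x, x)` acts transitively on `C(x, y)` by precomposition. -/
def SourceActsTransitively {C : Type*} [Category C] (x y : C) : Prop :=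
  ∀ α β : x ⟶ y, ∃ g : x ⟶ x, g ≫ α = β

/-- `H = C(y, y)` acts transitively on `C(x, y)` by postcomposition. -/
def TargetActsTransitively {C : Type*} [Category C] (x y : C) : Prop :=
  ∀ α β : x ⟶ y, ∃ h : y ⟶ y, α ≫ h = β

/-! Write I = H\C(x,y) and J = C(x,y)/G. For each scalar c, let `x` carry k^I and `y` carry k^J,
with automorphisms permuting the bases and a : x ⟶ y acting by E_a + c·𝟏. Here E_a is the matrix
unit at the two orbits of a, and 𝟏 is the all-ones matrix. Permutations fix 𝟏, and there is no
morphism y ⟶ x, so this is functorial (`familyMatrix_comp`). An isomorphism between parameters c and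
d is a pair (K, L) with L(E_a + c𝟏) = (E_a + d𝟏)K for all a. Comparing entries makes K and L the
same nonzero scalar, whence c = d (`param_eq_of_intertwining`). As k is infinite, this gives
infinitely many isomorphism classes of one dimension. Finite type allows only finitely many
(`finite_classes_of_dimAt_le`), so the members of the family need not be indecomposable. -/

namespace TwoObjectEI

universe u v w

/-! ### Representations and their isomorphisms in terms of matrices. -/

section Matrices

variable {k : Type u} [Field k] {C : Type v} [Category.{w} C] {ι : C → Type w}
  [∀ z, Fintype (ι z)] [∀ z, DecidableEq (ι z)]

/-- The representation given by a multiplicative family of matrices, with the index types replaced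
by `Fin n` so that the spaces live in the universe of `k`. -/
noncomputable def repOfMatrices (M : ∀ {z z' : C}, (z ⟶ z') → Matrix (ι z') (ι z) k)
    (hid : ∀ z, M (𝟙 z) = 1)
    (hcomp : ∀ {z z' z'' : C} (f : z ⟶ z') (g : z' ⟶ z''), M (f ≫ g) = M g * M f) :
    CatRep k C where
  obj z := FGModuleCat.of k (Fin (Fintype.card (ι z)) → k)
  map {z z'} f := FGModuleCat.ofHom (Matrix.toLin'
    ((M f).submatrix (Fintype.equivFin (ι z')).symm (Fintype.equivFin (ι z)).symm))
  map_id z := by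
    rw [hid, Matrix.submatrix_one_equiv, Matrix.toLin'_one]
    rfl
  map_comp {z z' z''} f g := by
    rw [hcomp, ← Matrix.submatrix_mul_equiv _ _ _ (Fintype.equivFin (ι z')).symm,
      Matrix.toLin'_mul]
    rfl

/-- An isomorphism of representations given by matrices is given by invertible matrices. -/
theorem exists_matrices_of_iso {M N : ∀ {z z' : C}, (z ⟶ z') → Matrix (ι z') (ι z) k}
    {hM hM' hN hN'} (e : repOfMatrices M hM hM' ≅ repOfMatrices N hN hN') :
    ∃ A : ∀ z, Matrix (ι z) (ι z) k, (∀ z, IsUnit (A z)) ∧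
      ∀ {z z' : C} (f : z ⟶ z'), A z' * M f = N f * A z := by
  let φ (z : C) : (Fin (Fintype.card (ι z)) → k) →ₗ[k] (Fin (Fintype.card (ι z)) → k) :=
    (e.hom.app z).hom.hom
  let ψ (z : C) : (Fin (Fintype.card (ι z)) → k) →ₗ[k] (Fin (Fintype.card (ι z)) → k) :=
    (e.inv.app z).hom.hom
  have hψφ (z : C) : ψ z ∘ₗ φ z = LinearMap.id :=
    congrArg (fun t => t.hom.hom) (e.hom_inv_id_app z)
  refine ⟨fun z => (LinearMap.toMatrix' (φ z)).submatrix (Fintype.equivFin (ι z))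
    (Fintype.equivFin (ι z)), fun z => ?_, fun {z z'} f => ?_⟩
  · refine IsUnit.of_mul_eq_one_right ( (LinearMap.toMatrix' (ψ z)).submatrix
      (Fintype.equivFin (ι z)) (Fintype.equivFin (ι z))) ?_
    rw [Matrix.submatrix_mul_equiv, ← LinearMap.toMatrix'_comp, hψφ, LinearMap.toMatrix'_id,
      Matrix.submatrix_one_equiv]
  · have h := congrArg (fun t => LinearMap.toMatrix' t.hom.hom) (e.hom.naturality f)
    have h' : LinearMap.toMatrix' (φ z' ∘ₗ Matrix.toLin'
        ((M f).submatrix (Fintype.equivFin (ι z')).symm (Fintype.equivFin (ι z)).symm)) =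
      LinearMap.toMatrix' (Matrix.toLin'
        ((N f).submatrix (Fintype.equivFin (ι z')).symm (Fintype.equivFin (ι z)).symm) ∘ₗ φ z) := h
    rw [LinearMap.toMatrix'_comp, LinearMap.toMatrix'_comp, LinearMap.toMatrix'_toLin',
      LinearMap.toMatrix'_toLin'] at h'
    have h2 := congrArg (fun B => B.submatrix (Fintype.equivFin (ι z')) (Fintype.equivFin (ι z))) h'
    simp only [← Matrix.submatrix_mul_equiv _ _ _ (Fintype.equivFin (ι z')) _,
      ← Matrix.submatrix_mul_equiv _ _ _ (Fintype.equivFin (ι z)) _, Matrix.submatrix_submatrix,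
      Equiv.symm_comp_self, Matrix.submatrix_id_id] at h2
    exact h2

end Matrices

/-! ### Finite type bounds the number of classes in each dimension. -/

section BoundedDimension

open scoped ZeroObject

variable {k : Type u} [Field k] {C : Type v} [Category.{w} C]

/-- The sum of the dimensions of the values of a representation at two objects. -/
noncomputable def dimAt (x y : C) (R : CatRep k C) : ℕ :=
  Module.finrank k (R.obj x) + Module.finrank k (R.obj y)

theorem finrank_biprod (Y Z : CatRep k C) (z : C) :
    Module.finrank k ((Y ⊞ Z).obj z) =
      Module.finrank k (Y.obj z) + Module.finrank k (Z.obj z) := by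
  let i₁ : Y.obj z →ₗ[k] (Y ⊞ Z).obj z := ((biprod.inl : Y ⟶ Y ⊞ Z).app z).hom.hom
  let i₂ : Z.obj z →ₗ[k] (Y ⊞ Z).obj z := ((biprod.inr : Z ⟶ Y ⊞ Z).app z).hom.hom
  let p₁ : (Y ⊞ Z).obj z →ₗ[k] Y.obj z := ((biprod.fst : Y ⊞ Z ⟶ Y).app z).hom.hom
  let p₂ : (Y ⊞ Z).obj z →ₗ[k] Z.obj z := ((biprod.snd : Y ⊞ Z ⟶ Z).app z).hom.hom
  have h11 : p₁ ∘ₗ i₁ = LinearMap.id :=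
    congrArg (fun t => (t.app z).hom.hom) (biprod.inl_fst (X := Y) (Y := Z))
  have h12 : p₁ ∘ₗ i₂ = 0 :=
    congrArg (fun t => (t.app z).hom.hom) (biprod.inr_fst (X := Y) (Y := Z))
  have h21 : p₂ ∘ₗ i₁ = 0 :=
    congrArg (fun t => (t.app z).hom.hom) (biprod.inl_snd (X := Y) (Y := Z))
  have h22 : p₂ ∘ₗ i₂ = LinearMap.id :=
    congrArg (fun t => (t.app z).hom.hom) (biprod.inr_snd (X := Y) (Y := Z))
  have htot : i₁ ∘ₗ p₁ + i₂ ∘ₗ p₂ = LinearMap.id :=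
    congrArg (fun t => (t.app z).hom.hom) (biprod.total (X := Y) (Y := Z))
  have e : (Y ⊞ Z).obj z ≃ₗ[k] (Y.obj z × Z.obj z) :=
    LinearEquiv.ofLinearMap (p₁.prod p₂) (i₁.coprod i₂)
      (by rw [LinearMap.prod_comp, LinearMap.comp_coprod, LinearMap.comp_coprod, h11, h12, h21, h22]
          ext <;> simp)
      (by rw [LinearMap.coprod_comp_prod, htot])
  rw [e.finrank_eq, Module.finrank_prod]

theorem dimAt_biprod (x y : C) (Y Z : CatRep k C) :
    dimAt x y (Y ⊞ Z) = dimAt x y Y + dimAt x y Z := by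
  simp only [dimAt, finrank_biprod]
  omega

theorem dimAt_eq_of_iso (x y : C) {R S : CatRep k C} (e : R ≅ S) : dimAt x y R = dimAt x y S := by
  have h (z : C) : Module.finrank k (R.obj z) = Module.finrank k (S.obj z) :=
    ((FGModuleCat.isoToLinearEquiv (e.app z))).finrank_eq
  rw [dimAt, dimAt, h, h]

theorem isZero_of_dimAt_eq_zero {x y : C} (hobj : ∀ z : C, z = x ∨ z = y) {R : CatRep k C}
    (hR : dimAt x y R = 0) : IsZero R := by
  have h (z : C) : Module.finrank k (R.obj z) = 0 := by
    unfold dimAt at hR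
    rcases hobj z with rfl | rfl <;> omega
  rw [IsZero.iff_id_eq_zero]
  ext z v
  have := Module.finrank_zero_iff.mp (h z)
  exact Subsingleton.elim (α := R.obj z) _ _

/-- If there are finitely many indecomposables up to isomorphism, then there are finitely many
representations of bounded dimension up to isomorphism. -/
theorem finite_classes_of_dimAt_le {x y : C} (hobj : ∀ z : C, z = x ∨ z = y)
    (hfin : IsFiniteRepType k C) (n : ℕ) :
    {c : Quotient (isIsomorphicSetoid (CatRep k C)) |
      ∃ R : CatRep k C, dimAt x y R ≤ n ∧
        Quotient.mk (isIsomorphicSetoid (CatRep k C)) R = c}.Finite := by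
  let q : CatRep k C → Quotient (isIsomorphicSetoid (CatRep k C)) := Quotient.mk _
  induction n with
  | zero =>
    refine Set.Finite.subset (Set.finite_singleton (q 0)) ?_
    rintro _ ⟨R, hR, rfl⟩
    exact Quotient.sound ⟨(isZero_of_dimAt_eq_zero hobj (by omega)).iso (isZero_zero _)⟩
  | succ n ih =>
    -- A decomposable nonzero representation splits into two nonzero summands, each of dimension at
    -- most n, so its class is a sum of two classes from the induction hypothesis.
    let add (a b : Quotient (isIsomorphicSetoid (CatRep k C))) := q (a.out ⊞ b.out)
    refine Set.Finite.subset ((hfin.union (Set.finite_singleton (q 0))).union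
      (Set.Finite.image2 add ih ih)) ?_
    rintro _ ⟨R, hR, rfl⟩
    by_cases hz : IsZero R
    · exact Or.inl (Or.inr (Quotient.sound ⟨hz.iso (isZero_zero _)⟩))
    by_cases hi : Indecomposable R
    · exact Or.inl (Or.inl ⟨R, hi, rfl⟩)
    have : ∃ Y Z : CatRep k C, Nonempty (R ≅ Y ⊞ Z) ∧ ¬ IsZero Y ∧ ¬ IsZero Z := by
      by_contra! hcon
      refine hi ⟨hz, fun Y Z e => ?_⟩
      by_cases hY : IsZero Y
      · exact Or.inl hY
      · exact Or.inr (hcon Y Z ⟨e⟩ hY)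
    obtain ⟨Y, Z, ⟨e⟩, hY, hZ⟩ := this
    have hd := (dimAt_eq_of_iso x y e).trans (dimAt_biprod x y Y Z)
    have hY0 : dimAt x y Y ≠ 0 := fun h => hY (isZero_of_dimAt_eq_zero hobj h)
    have hZ0 : dimAt x y Z ≠ 0 := fun h => hZ (isZero_of_dimAt_eq_zero hobj h)
    refine Or.inr ⟨q Y, ⟨Y, by omega, rfl⟩, q Z, ⟨Z, by omega, rfl⟩, Quotient.sound ?_⟩
    obtain ⟨eY⟩ : Nonempty ((q Y).out ≅ Y) := Quotient.exact (Quotient.out_eq (q Y))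
    obtain ⟨eZ⟩ : Nonempty ((q Z).out ≅ Z) := Quotient.exact (Quotient.out_eq (q Z))
    exact ⟨biprod.mapIso eY eZ ≪≫ e.symm⟩

end BoundedDimension

/-! ### Orbits of morphisms under automorphisms of one end. -/

section Orbits

variable {C : Type v} [Category.{w} C]

/-- Morphisms `z ⟶ y` up to automorphisms of `y`. -/
def targetSetoid (z y : C) : Setoid (z ⟶ y) where
  r a b := ∃ h : y ≅ y, a ≫ h.hom = b
  iseqv :=
    { refl := fun a => ⟨Iso.refl y, Category.comp_id a⟩
      symm := by
        rintro a _ ⟨h, rfl⟩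
        exact ⟨h.symm, by simp⟩
      trans := by
        rintro a _ _ ⟨h, rfl⟩ ⟨h', rfl⟩
        exact ⟨h ≪≫ h', by simp⟩ }

/-- Morphisms `x ⟶ z` up to automorphisms of `x`. -/
def sourceSetoid (x z : C) : Setoid (x ⟶ z) where
  r a b := ∃ g : x ≅ x, g.hom ≫ a = b
  iseqv :=
    { refl := fun a => ⟨Iso.refl x, Category.id_comp a⟩
      symm := by
        rintro a _ ⟨g, rfl⟩
        exact ⟨g.symm, by simp⟩
      trans := by
        rintro a _ _ ⟨g, rfl⟩ ⟨g', rfl⟩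
        exact ⟨g' ≪≫ g, by simp⟩ }

/-- The orbits of `Aut y` on `z ⟶ y`. -/
abbrev TargetOrbit (z y : C) : Type w := Quotient (targetSetoid z y)

/-- The orbits of `Aut x` on `x ⟶ z`. -/
abbrev SourceOrbit (x z : C) : Type w := Quotient (sourceSetoid x z)

/-- The orbit of a morphism under automorphisms of its target. -/
abbrev targetOrbit {z y : C} (a : z ⟶ y) : TargetOrbit z y := Quotient.mk _ a

/-- The orbit of a morphism under automorphisms of its source. -/
abbrev sourceOrbit {x z : C} (a : x ⟶ z) : SourceOrbit x z := Quotient.mk _ a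

/-- Precomposition on orbits. -/
def TargetOrbit.pull {z z' y : C} (f : z ⟶ z') : TargetOrbit z' y → TargetOrbit z y :=
  Quotient.map (fun a => f ≫ a) (by
    rintro a _ ⟨h, rfl⟩
    exact ⟨h, by simp⟩)

/-- Postcomposition on orbits. -/
def SourceOrbit.push {x z z' : C} (f : z ⟶ z') : SourceOrbit x z → SourceOrbit x z' :=
  Quotient.map (fun a => a ≫ f) (by
    rintro a _ ⟨g, rfl⟩
    exact ⟨g, by simp⟩)

theorem TargetOrbit.pull_id {z y : C} (i : TargetOrbit z y) : pull (𝟙 z) i = i := by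
  induction i using Quotient.inductionOn with
  | h a => exact congrArg targetOrbit (Category.id_comp a)

theorem TargetOrbit.pull_comp {z z' z'' y : C} (f : z ⟶ z') (g : z' ⟶ z'')
    (i : TargetOrbit z'' y) : pull (f ≫ g) i = pull f (pull g i) := by
  induction i using Quotient.inductionOn with
  | h a => exact congrArg targetOrbit (Category.assoc f g a)

theorem SourceOrbit.push_id {x z : C} (j : SourceOrbit x z) : push (𝟙 z) j = j := by
  induction j using Quotient.inductionOn with
  | h a => exact congrArg sourceOrbit (Category.comp_id a)

theorem SourceOrbit.push_comp {x z z' z'' : C} (f : z ⟶ z') (g : z' ⟶ z'')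
    (j : SourceOrbit x z) : push (f ≫ g) j = push g (push f j) := by
  induction j using Quotient.inductionOn with
  | h a => exact congrArg sourceOrbit (Category.assoc a f g).symm

theorem TargetOrbit.pull_bijective {z z' y : C} (f : z ⟶ z') [IsIso f] :
    Function.Bijective (pull f : TargetOrbit z' y → TargetOrbit z y) :=
  Function.bijective_iff_has_inverse.mpr ⟨pull (inv f),
    fun i => by rw [← pull_comp, IsIso.inv_hom_id, pull_id],
    fun i => by rw [← pull_comp, IsIso.hom_inv_id, pull_id]⟩

theorem SourceOrbit.push_bijective {x z z' : C} (f : z ⟶ z') [IsIso f] :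
    Function.Bijective (push f : SourceOrbit x z → SourceOrbit x z') :=
  Function.bijective_iff_has_inverse.mpr ⟨push (inv f),
    fun i => by rw [← push_comp, IsIso.hom_inv_id, push_id],
    fun i => by rw [← push_comp, IsIso.inv_hom_id, push_id]⟩

end Orbits

/-! ### The one-parameter family and the rigidity of its parameter. -/

section Family

variable {k : Type u} [Field k] {C : Type v} [Category.{w} C]

open Classical in
/-- The matrix of `f` in the representation of the family with parameter `c`. -/
noncomputable def familyMatrix (x y : C) (c : k) {z z' : C} (f : z ⟶ z') :
    Matrix (TargetOrbit z' y × SourceOrbit x z') (TargetOrbit z y × SourceOrbit x z) k :=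
  fun p q => (if TargetOrbit.pull f p.1 = q.1 then 1 else 0) *
    (if SourceOrbit.push f q.2 = p.2 then 1 else 0) + if z = z' then 0 else c

open Classical in
theorem familyMatrix_id (x y : C) (c : k) (z : C) : familyMatrix x y c (𝟙 z) = 1 := by
  ext ⟨i, j⟩ ⟨i', j'⟩
  rw [familyMatrix, Matrix.one_apply, if_pos rfl, TargetOrbit.pull_id, SourceOrbit.push_id]
  by_cases hi : i = i' <;> by_cases hj : j = j' <;> simp [hi, hj, Ne.symm]

open Classical in
-- The 0-1 parts compose by functoriality of orbits. At most one of the two factors carries the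
-- constant c, and the other is then a permutation matrix, whose row and column sums are 1.
theorem familyMatrix_comp {x y : C} (c : k) (hEI : ∀ (z : C) (f : z ⟶ z), IsIso f)
    (hobj : ∀ z : C, z = x ∨ z = y) (hyx : IsEmpty (y ⟶ x))
    [∀ z z' : C, Fintype (TargetOrbit z z')] [∀ z z' : C, Fintype (SourceOrbit z z')]
    {z z' z'' : C} (f : z ⟶ z') (g : z' ⟶ z'') :
    familyMatrix x y c (f ≫ g) = familyMatrix x y c g * familyMatrix x y c f := by
  have key (i : TargetOrbit z'' y) (j : SourceOrbit x z'') (i' : TargetOrbit z y)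
      (j' : SourceOrbit x z) :
      ∑ p : TargetOrbit z' y × SourceOrbit x z',
        ((if TargetOrbit.pull g i = p.1 then (1 : k) else 0) *
          (if SourceOrbit.push g p.2 = j then 1 else 0)) *
        ((if TargetOrbit.pull f p.1 = i' then 1 else 0) *
          (if SourceOrbit.push f j' = p.2 then 1 else 0)) =
      (if TargetOrbit.pull (f ≫ g) i = i' then 1 else 0) *
        (if SourceOrbit.push (f ≫ g) j' = j then 1 else 0) := by
    rw [Finset.sum_eq_single (TargetOrbit.pull g i, SourceOrbit.push f j')]
    · simp only [TargetOrbit.pull_comp, SourceOrbit.push_comp, if_true]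
      ring
    · rintro ⟨a, b⟩ - hne
      by_cases ha : TargetOrbit.pull g i = a
      · by_cases hb : SourceOrbit.push f j' = b
        · exact absurd (by rw [ha, hb]) hne
        · simp [hb]
      · simp [ha]
    · simp
  ext ⟨i, j⟩ ⟨i', j'⟩
  rw [Matrix.mul_apply]
  simp only [familyMatrix]
  rw [← key]
  by_cases h1 : z = z'
  · subst h1
    by_cases h2 : z = z''
    · simp [h2]
    · have := hEI z f
      obtain ⟨i₀, hi₀, hu⟩ := (TargetOrbit.pull_bijective (y := y) f).existsUnique i'
      simp only [if_true, if_neg h2, add_zero, add_mul, Finset.sum_add_distrib, add_right_inj]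
      -- The only nonzero entry in this column of the permutation matrix of `f`.
      rw [Finset.sum_eq_single (i₀, SourceOrbit.push f j')]
      · simp [hi₀]
      · rintro ⟨a, b⟩ - hne
        by_cases ha : TargetOrbit.pull f a = i'
        · by_cases hb : SourceOrbit.push f j' = b
          · exact absurd (by rw [hu a ha, hb]) hne
          · simp [hb]
        · simp [ha]
      · simp
  · have h2 : z' = z'' := by
      by_contra h2
      rcases hobj z with rfl | rfl <;> rcases hobj z' with rfl | rfl <;>
        rcases hobj z'' with rfl | rfl <;> first | contradiction | exact hyx.elim ‹_›
    subst h2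
    have := hEI z' g
    obtain ⟨j₀, hj₀, hu⟩ := (SourceOrbit.push_bijective (x := x) g).existsUnique j
    simp only [if_true, if_neg h1, add_zero, mul_add, Finset.sum_add_distrib, add_right_inj]
    rw [Finset.sum_eq_single (TargetOrbit.pull g i, j₀)]
    · simp [hj₀]
    · rintro ⟨a, b⟩ - hne
      by_cases ha : TargetOrbit.pull g i = a
      · by_cases hb : SourceOrbit.push g b = j
        · exact absurd (by rw [ha, hu b hb]) hne
        · simp [hb]
      · simp [ha]
    · simp

theorem subsingleton_sourceOrbit_self {x : C} (hEI : ∀ f : x ⟶ x, IsIso f) :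
    Subsingleton (SourceOrbit x x) := by
  refine ⟨fun i j => ?_⟩
  induction i, j using Quotient.inductionOn₂ with
  | h a b =>
    have := hEI a
    have := hEI b
    exact Quotient.sound ⟨asIso b ≪≫ (asIso a).symm, by simp⟩

theorem subsingleton_targetOrbit_self {y : C} (hEI : ∀ f : y ⟶ y, IsIso f) :
    Subsingleton (TargetOrbit y y) := by
  refine ⟨fun i j => ?_⟩
  induction i, j using Quotient.inductionOn₂ with
  | h a b =>
    have := hEI a
    have := hEI b
    exact Quotient.sound ⟨(asIso a).symm ≪≫ asIso b, by simp⟩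

theorem exists_targetOrbit_ne {x y : C} (hH : ¬ TargetActsTransitively x y) (i : TargetOrbit x y) : ∃ i' : TargetOrbit x y, i ≠ i' := by
  by_contra! h
  refine hH fun a b => ?_
  obtain ⟨g, hg⟩ : (targetSetoid x y).r a b :=
    Quotient.exact ((h (targetOrbit a)).symm.trans (h (targetOrbit b)))
  exact ⟨g.hom, hg⟩

theorem exists_sourceOrbit_ne {x y : C} (hG : ¬ SourceActsTransitively x y) (j : SourceOrbit x y) : ∃ j' : SourceOrbit x y, j ≠ j' := by
  by_contra! h
  refine hG fun a b => ?_
  obtain ⟨g, hg⟩ : (sourceSetoid x y).r a b :=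
    Quotient.exact ((h (sourceOrbit a)).symm.trans (h (sourceOrbit b)))
  exact ⟨g.hom, hg⟩

/-- In an EI category, a morphism in the opposite direction would make `G` act transitively. -/
theorem isEmpty_reverse_hom {x y : C} (hEI : ∀ (z : C) (f : z ⟶ z), IsIso f)
    (hG : ¬ SourceActsTransitively x y) : IsEmpty (y ⟶ x) := by
  refine ⟨fun r => hG fun a b => ?_⟩
  have := hEI x (a ≫ r)
  have := hEI y (r ≫ a)
  refine ⟨b ≫ inv (r ≫ a) ≫ r, ?_⟩
  simp only [Category.assoc, IsIso.inv_hom_id, Category.comp_id]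

open Classical in
/-- Intertwining matrices between two members of the family force their parameters to agree. -/
theorem param_eq_of_intertwining {x y : C} (hxy : x ≠ y)
    (hEI : ∀ (z : C) (f : z ⟶ z), IsIso f) (horbit : IsSingleBisetOrbit x y)
    (hG : ¬ SourceActsTransitively x y) (hH : ¬ TargetActsTransitively x y)
    [∀ z z' : C, Fintype (TargetOrbit z z')] [∀ z z' : C, Fintype (SourceOrbit z z')]
    {c d : k} (A : ∀ z : C, Matrix (TargetOrbit z y × SourceOrbit x z)
      (TargetOrbit z y × SourceOrbit x z) k) (hA : IsUnit (A y))
    (hcomm : ∀ {z z' : C} (f : z ⟶ z'),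
      A z' * familyMatrix x y c f = familyMatrix x y d f * A z) : c = d := by
  have := subsingleton_sourceOrbit_self (hEI x)
  have := subsingleton_targetOrbit_self (hEI y)
  let jx : SourceOrbit x x := sourceOrbit (𝟙 x)
  let iy : TargetOrbit y y := targetOrbit (𝟙 y)
  let K (i i' : TargetOrbit x y) : k := A x (i, jx) (i', jx)
  let L (j j' : SourceOrbit x y) : k := A y (iy, j) (iy, j')
  have hpull (a : x ⟶ y) : TargetOrbit.pull a iy = targetOrbit a :=
    congrArg targetOrbit (Category.comp_id a)
  have hpush (a : x ⟶ y) : SourceOrbit.push a jx = sourceOrbit a :=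
    congrArg sourceOrbit (Category.id_comp a)
  -- The (j, i) entry of L(E_a + c𝟏) = (E_a + d𝟏)K.
  have hcross (a : x ⟶ y) (i : TargetOrbit x y) (j : SourceOrbit x y) :
      (if targetOrbit a = i then L j (sourceOrbit a) else 0) + c * ∑ j', L j j' =
        (if sourceOrbit a = j then K (targetOrbit a) i else 0) + d * ∑ i', K i' i := by
    have h := congrFun (congrFun (hcomm a) (iy, j)) (i, jx)
    simp only [Matrix.mul_apply, Fintype.sum_prod_type, Fintype.sum_subsingleton _ iy,
      Fintype.sum_subsingleton _ jx, familyMatrix, hpull, hpush, if_neg hxy] at h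
    simpa [mul_add, add_mul, Finset.sum_add_distrib, ← Finset.sum_mul, ← Finset.mul_sum,
      mul_comm c, K, L] using h
  have hK (g : x ⟶ x) (i i' : TargetOrbit x y) :
      K i i' = K (TargetOrbit.pull g i) (TargetOrbit.pull g i') := by
    have := hEI x g
    have hinj := (TargetOrbit.pull_bijective (y := y) g).injective
    have h := congrFun (congrFun (hcomm g) (i, jx)) (TargetOrbit.pull g i', jx)
    simp only [Matrix.mul_apply, Fintype.sum_prod_type, Fintype.sum_subsingleton _ jx,
      familyMatrix, hinj.eq_iff, Subsingleton.elim (SourceOrbit.push g jx) jx] at h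
    simpa using h
  have hL (g : y ⟶ y) (j j' : SourceOrbit x y) :
      L j j' = L (SourceOrbit.push g j) (SourceOrbit.push g j') := by
    have := hEI y g
    have hinj := (SourceOrbit.push_bijective (x := x) g).injective
    have h := congrFun (congrFun (hcomm g) (iy, SourceOrbit.push g j)) (iy, j')
    simp only [Matrix.mul_apply, Fintype.sum_prod_type, Fintype.sum_subsingleton _ iy,
      familyMatrix, hinj.eq_iff, Subsingleton.elim (TargetOrbit.pull g iy) iy] at h
    simpa using h.symm
  obtain ⟨α, hα⟩ := horbit
  -- As C(x,y) = HαG, G permutes I transitively; K commutes with this action, so its column sums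
  -- agree. Dually for the row sums of L.
  have hκ (i : TargetOrbit x y) : ∑ i', K i' i = ∑ i', K i' (targetOrbit α) := by
    induction i using Quotient.inductionOn with
    | h a =>
      obtain ⟨g, h, rfl⟩ := hα a
      have := hEI x g
      have := hEI y h
      have e : TargetOrbit.pull g (targetOrbit α) = targetOrbit (g ≫ α ≫ h) :=
        Quotient.sound ⟨asIso h, by simp⟩
      refine Eq.trans ?_ ((TargetOrbit.pull_bijective (y := y) g).sum_comp
        (fun i' => K i' (targetOrbit (g ≫ α ≫ h)))).symm |>.trans ?_
      · rfl
      · exact Finset.sum_congr rfl fun i' _ => by rw [← e, ← hK]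
  have hρ (j : SourceOrbit x y) : ∑ j', L j j' = ∑ j', L (sourceOrbit α) j' := by
    induction j using Quotient.inductionOn with
    | h a =>
      obtain ⟨g, h, rfl⟩ := hα a
      have := hEI x g
      have := hEI y h
      have e : SourceOrbit.push h (sourceOrbit α) = sourceOrbit (g ≫ α ≫ h) :=
        Quotient.sound ⟨asIso g, by simp⟩
      refine Eq.trans ?_ ((SourceOrbit.push_bijective (x := x) h).sum_comp
        (fun j' => L (sourceOrbit (g ≫ α ≫ h)) j')).symm |>.trans ?_
      · rfl
      · exact Finset.sum_congr rfl fun j' _ => by rw [← e, ← hL]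
  simp only [hκ, hρ] at hcross
  set κ := ∑ i', K i' (targetOrbit α) with hκdef
  set ρ := ∑ j', L (sourceOrbit α) j' with hρdef
  -- Both failures of transitivity enter here: they provide an entry outside the row and the column
  -- of α, where E_α contributes nothing.
  have hcd : c * ρ = d * κ := by
    obtain ⟨i, hi⟩ := exists_targetOrbit_ne hH (targetOrbit α)
    obtain ⟨j, hj⟩ := exists_sourceOrbit_ne hG (sourceOrbit α)
    simpa [hi, hj] using hcross α i j
  have hL0 (j j' : SourceOrbit x y) (hne : j' ≠ j) : L j j' = 0 := by
    induction j' using Quotient.inductionOn with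
    | h a => simpa [hne, hcd] using hcross a (targetOrbit a) j
  have hK0 (i i' : TargetOrbit x y) (hne : i ≠ i') : K i i' = 0 := by
    induction i using Quotient.inductionOn with
    | h a => simpa [hne, hcd] using (hcross a i' (sourceOrbit a)).symm
  have hρL (j : SourceOrbit x y) : L j j = ρ := by
    rw [← hρ j]
    exact (Finset.sum_eq_single j (fun j' _ hne => hL0 j j' hne) (by simp)).symm
  have hκK (i : TargetOrbit x y) : K i i = κ := by
    rw [← hκ i]
    exact (Finset.sum_eq_single i (fun i' _ hne => hK0 i' i hne) (by simp)).symm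
  -- The entry at both orbits of α, after cancelling the constant terms.
  have hρκ : ρ = κ := by
    simpa [hρL, hκK, hcd] using hcross α (targetOrbit α) (sourceOrbit α)
  have hρ0 : ρ ≠ 0 := by
    intro h0
    have hA0 : A y = 0 := by
      ext ⟨i, j⟩ ⟨i', j'⟩
      rw [Subsingleton.elim i iy, Subsingleton.elim i' iy]
      by_cases hj : j' = j
      · subst hj
        exact (hρL j').trans h0
      · exact hL0 j j' hj
    have : Nonempty (TargetOrbit y y × SourceOrbit x y) := ⟨(iy, sourceOrbit α)⟩
    rw [hA0] at hA
    exact not_isUnit_zero hA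
  exact mul_right_cancel₀ hρ0 (hcd.trans (by rw [hρκ]))

end Family

end TwoObjectEI

theorem proposition6p9 {k : Type*} [Field k] [IsAlgClosed k]
    {C : Type*} [Category C] (hC : IsFiniteEI C)
    (x y : C) (hxy : x ≠ y) (hobj : ∀ z : C, z = x ∨ z = y)
    (horbit : IsSingleBisetOrbit x y)
    (hG : ¬ SourceActsTransitively x y) (hH : ¬ TargetActsTransitively x y) :
    IsInfiniteRepType k C := by
  classical
  intro hfin
  have hEI := hC.isIso_of_end
  have hyx := TwoObjectEI.isEmpty_reverse_hom hEI hG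
  have hhom (z z' : C) : Finite (z ⟶ z') := by
    have := hC.finite_mor
    refine Finite.of_injective
      (fun f : z ⟶ z' => (⟨z, z', f⟩ : Σ (x : C) (y : C), x ⟶ y)) fun f g h => ?_
    simpa using h
  have (z z' : C) : Fintype (TwoObjectEI.TargetOrbit z z') := Fintype.ofFinite _
  have (z z' : C) : Fintype (TwoObjectEI.SourceOrbit z z') := Fintype.ofFinite _
  let R (c : k) : CatRep k C := TwoObjectEI.repOfMatrices
    (ι := fun z => TwoObjectEI.TargetOrbit z y × TwoObjectEI.SourceOrbit x z)
    (TwoObjectEI.familyMatrix x y c) (TwoObjectEI.familyMatrix_id x y c)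
    (TwoObjectEI.familyMatrix_comp c hEI hobj hyx)
  have hinj : Function.Injective
      (fun c => Quotient.mk (isIsomorphicSetoid (CatRep k C)) (R c)) := by
    intro c d h
    obtain ⟨e⟩ : Nonempty (R c ≅ R d) := Quotient.exact h
    obtain ⟨A, hA, hcomm⟩ := TwoObjectEI.exists_matrices_of_iso e
    exact TwoObjectEI.param_eq_of_intertwining hxy hEI horbit hG hH A (hA y) hcomm
  have : Infinite k := inferInstance
  -- The spaces of `R c` do not depend on `c`, so `R 0` bounds every dimension.
  exact Set.infinite_range_of_injective hinj
    ((TwoObjectEI.finite_classes_of_dimAt_le hobj hfin (TwoObjectEI.dimAt x y (R 0))).subset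
      (Set.range_subset_iff.mpr fun c => ⟨R c, le_rfl, rfl⟩))
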